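/- Let $i,j,p$ be integers with $0<i<j$, $\gcd(2j,i,j)=1$ and $p\ge 1$. Let $G=C_{2j}(i,j_{\div p})$ be the simple graph with vertices $u_a$ and $v_a^r$ for $a\in\mathbb{Z}_{2j}$ and $1\le r\le p$, whose edges are the edges $u_au_{a+i}$ together with the edges of the paths $(u_a,v_a^1,v_a^2,\dots,v_a^p,u_{a+j})$, for all $a\in\mathbb{Z}_{2j}$. Let $H'$ be the group of units $t$ of $\mathbb{Z}_{2j}$ whose multiplication preserves each of the sets $\{\pm i\}$ and $\{\pm j\}$, and let $\mathbb{Z}_{2j}\rtimes H'$ (with product $(s,t)(s',t')=(s+ts',tt')$) act on $G$ by the automorphisms $(s,t)\cdot u_a=u_{s+ta}$, $(s,t)\cdot v_a^r=v_{s+ta}^r$. For $a\in\mathbb{Z}_{2j}$ let $\beta_a$ be the automorphism of $G$ with $\beta_a(v_b^r)=v_{b+j}^{p+1-r}$ for $b\in\{a,a+j\}$, $1\le r\le p$, that fixes all other vertices, and let $B=\langle\beta_a\mid 0\le a<j\rangle\le\mathrm{Aut}(G)$. Then $H'=\{\pm1\}$, the subgroup $B$ is normal in $\mathrm{Aut}(G)$,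 and $$\mathrm{Aut}(G)=B\rtimes(\mathbb{Z}_{2j}\rtimes H')=B\rtimes(\mathbb{Z}_{2j}\rtimes\{\pm1\})\cong(\mathbb{Z}_2)^j\rtimes D_{4j},$$ where $D_{4j}$ is the dihedral group of order $4j$. That is, with $\mathbb{Z}_{2j}\rtimes H'$ acting on $B$ by $\beta_a\mapsto\beta_{s+ta}$, the map $(\beta,(s,t))\mapsto\beta\circ(s,t)$ is a group isomorphism from $B\rtimes(\mathbb{Z}_{2j}\rtimes H')$ onto $\mathrm{Aut}(G)$; there is an isomorphism $(\mathbb{Z}_2)^j\cong B$ taking the standard generators to $\beta_0,\dots,\beta_{j-1}$; there is an isomorphism $\mathbb{Z}_{2j}\rtimes H'\cong D_{4j}$ taking each $(s,1)$ to the rotation $r^s$; and, for the action of $D_{4j}$ on $(\mathbb{Z}_2)^j$ that corresponds under these two isomorphisms to the action of $\mathbb{Z}_{2j}\rtimes H'$ on $B$, $\mathrm{Aut}(G)\cong(\mathbb{Z}_2)^j\rtimes D_{4j}$. -/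

import Mathlib

open scoped Pointwise

/-- Vertices of the circulant graph `C_n(i, j)` with the `j`-arcs subdivided by `p` vertices:
`u a` for `a ∈ ℤ/n`, and `v a r` for `a ∈ ℤ/n` and `r ∈ {1, …, p}`
(the index `r : Fin p` stands for `r + 1`). -/
inductive SubdivVertex (n p : ℕ) : Type
  | u (a : ZMod n) : SubdivVertex n p
  | v (a : ZMod n) (r : Fin p) : SubdivVertex n p

/-- The arcs of the derived digraph of the bouquet of two loops with voltages `i, j` in `ℤ/n`, the
`j`-loop being subdivided by `p ≥ 1` vertices: the arcs `u_a → u_{a+i}`, and the arcs of the paths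
`u_a → v_a^1 → ⋯ → v_a^p → u_{a+j}`. -/
inductive SubdivArc (n i j p : ℕ) : SubdivVertex n p → SubdivVertex n p → Prop
  | circ (a : ZMod n) : SubdivArc n i j p (.u a) (.u (a + (i : ZMod n)))
  | first (a : ZMod n) (r : Fin p) (hr : (r : ℕ) = 0) : SubdivArc n i j p (.u a) (.v a r)
  | next (a : ZMod n) (r r' : Fin p) (hr : (r' : ℕ) = (r : ℕ) + 1) :
      SubdivArc n i j p (.v a r) (.v a r')
  | last (a : ZMod n) (r : Fin p) (hr : (r : ℕ) + 1 = p) :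
      SubdivArc n i j p (.v a r) (.u (a + (j : ZMod n)))

/-- The subdivided circulant graph `C_n(i, j_÷p)` (for `p ≥ 1`): the underlying simple graph of the
derived digraph. -/
def subdivCirculant (n i j p : ℕ) : SimpleGraph (SubdivVertex n p) :=
  SimpleGraph.fromRel (SubdivArc n i j p)

/-- The group `H` of units of `ℤ/n` whose multiplication preserves the set `{±i, ±j}`. -/
def unitStab (n i j : ℕ) : Subgroup (ZMod n)ˣ :=
  MulAction.stabilizer (ZMod n)ˣ ({(i : ZMod n), -(i : ZMod n), (j : ZMod n), -(j : ZMod n)} :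
    Set (ZMod n))

/-- The group `H'` of those elements of `H` that preserve each of `{±i}` and `{±j}`. -/
def unitStab' (n i j : ℕ) : Subgroup (ZMod n)ˣ :=
  unitStab n i j ⊓
    (MulAction.stabilizer (ZMod n)ˣ ({(i : ZMod n), -(i : ZMod n)} : Set (ZMod n)) ⊓
      MulAction.stabilizer (ZMod n)ˣ ({(j : ZMod n), -(j : ZMod n)} : Set (ZMod n)))

/-- A group `H` of units of `ℤ/n` acting on the additive group `ℤ/n` by multiplication. -/
def unitAction (n : ℕ) (H : Subgroup (ZMod n)ˣ) : H →* MulAut (Multiplicative (ZMod n)) :=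
  (MulAutMultiplicative (ZMod n)).symm.toMonoidHom.comp (AddAut.mulLeft.comp H.subtype)

/-- The semidirect product `ℤ/n ⋊ H'`; its product is `(s, t) (s', t') = (s + t s', t t')`. -/
abbrev AffineGroup (n i j : ℕ) : Type :=
  Multiplicative (ZMod n) ⋊[unitAction n (unitStab' n i j)] (unitStab' n i j)

/-- The affine map `a ↦ s + t a` of `ℤ/n` given by `(s, t) ∈ ℤ/n ⋊ H'`. -/
def AffineGroup.app {n i j : ℕ} (d : AffineGroup n i j) (a : ZMod n) : ZMod n :=
  Multiplicative.toAdd d.left + ((d.right : (ZMod n)ˣ) : ZMod n) * a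

theorem AffineGroup.app_one {n i j : ℕ} (a : ZMod n) : (1 : AffineGroup n i j).app a = a := by
  simp [AffineGroup.app]

theorem AffineGroup.app_mul {n i j : ℕ} (d e : AffineGroup n i j) (a : ZMod n) :
    (d * e).app a = d.app (e.app a) := by
  simp [AffineGroup.app, unitAction, mul_add, mul_assoc, add_assoc]
  rfl

theorem two_mul_cast_self (j : ℕ) : (j : ZMod (2 * j)) + (j : ZMod (2 * j)) = 0 := by
  have h : ((2 * j : ℕ) : ZMod (2 * j)) = 0 := ZMod.natCast_self _
  push_cast at h
  linear_combination h

theorem unitStab'_mul_left {n i j : ℕ} {t : (ZMod n)ˣ} (ht : t ∈ unitStab' n i j) :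
    (t : ZMod n) * i = i ∨ (t : ZMod n) * i = -i := by
  have h := MulAction.mem_stabilizer_iff.1 ht.2.1
  have h2 : t • (i : ZMod n) ∈ ({(i : ZMod n), -(i : ZMod n)} : Set (ZMod n)) := by
    rw [← h]
    exact Set.smul_mem_smul_set (by simp)
  simpa [Units.smul_def] using h2

theorem unitStab'_mul_right {i j : ℕ} {t : (ZMod (2 * j))ˣ} (ht : t ∈ unitStab' (2 * j) i j) :
    (t : ZMod (2 * j)) * j = j := by
  have h := MulAction.mem_stabilizer_iff.1 ht.2.2
  have h2 : t • (j : ZMod (2 * j)) ∈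
      ({(j : ZMod (2 * j)), -(j : ZMod (2 * j))} : Set (ZMod (2 * j))) := by
    rw [← h]
    exact Set.smul_mem_smul_set (by simp)
  have h3 := two_mul_cast_self j
  have h4 : -(j : ZMod (2 * j)) = j := by linear_combination -h3
  rw [h4] at h2
  simpa [Units.smul_def] using h2

/-- A permutation of the vertices that, together with its inverse, maps arcs to arcs up to
orientation is a graph automorphism. -/
def autOfArc {n i j p : ℕ} (σ : Equiv.Perm (SubdivVertex n p))
    (h : ∀ x y, SubdivArc n i j p x y →
      SubdivArc n i j p (σ x) (σ y) ∨ SubdivArc n i j p (σ y) (σ x))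
    (h' : ∀ x y, SubdivArc n i j p x y →
      SubdivArc n i j p (σ.symm x) (σ.symm y) ∨ SubdivArc n i j p (σ.symm y) (σ.symm x)) :
    subdivCirculant n i j p ≃g subdivCirculant n i j p where
  toEquiv := σ
  map_rel_iff' := by
    intro x y
    simp only [subdivCirculant, SimpleGraph.fromRel_adj, ne_eq, EmbeddingLike.apply_eq_iff_eq]
    refine and_congr_right fun _ => ⟨?_, ?_⟩
    · rintro (hh | hh)
      · simpa using h' _ _ hh
      · simpa [or_comm] using h' _ _ hh
    · rintro (hh | hh)
      · exact h _ _ hh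
      · exact (h _ _ hh).symm

/-- The action of `(s, t)` on vertices: `u_a ↦ u_{s+ta}` and `v_a^r ↦ v_{s+ta}^r`. -/
def affineMap {n i j p : ℕ} (d : AffineGroup n i j) : SubdivVertex n p → SubdivVertex n p
  | .u a => .u (d.app a)
  | .v a r => .v (d.app a) r

/-- The permutation of the vertices given by `(s, t)`. -/
def affinePerm {n i j p : ℕ} (d : AffineGroup n i j) : Equiv.Perm (SubdivVertex n p) where
  toFun := affineMap d
  invFun := affineMap d⁻¹
  left_inv := by rintro (a | ⟨a, r⟩) <;> simp [affineMap, ← AffineGroup.app_mul, AffineGroup.app_one]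
  right_inv := by rintro (a | ⟨a, r⟩) <;> simp [affineMap, ← AffineGroup.app_mul, AffineGroup.app_one]

theorem affineMap_arc {i j p : ℕ} (d : AffineGroup (2 * j) i j)
    (x y : SubdivVertex (2 * j) p) (h : SubdivArc (2 * j) i j p x y) :
    SubdivArc (2 * j) i j p (affineMap d x) (affineMap d y) ∨
      SubdivArc (2 * j) i j p (affineMap d y) (affineMap d x) := by
  cases h with
  | circ a =>
    rcases unitStab'_mul_left d.right.2 with h | h
    · left
      have e : d.app (a + i) = d.app a + i := by
        simp only [AffineGroup.app]; linear_combination h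
      simpa only [affineMap, e] using SubdivArc.circ (d.app a)
    · right
      have e : d.app a = d.app (a + i) + i := by
        simp only [AffineGroup.app]; linear_combination -h
      simpa only [affineMap, ← e] using
        SubdivArc.circ (n := 2 * j) (i := i) (j := j) (p := p) (d.app (a + i))
  | first a r hr => exact Or.inl (SubdivArc.first _ r hr)
  | next a r r' hr => exact Or.inl (SubdivArc.next _ r r' hr)
  | last a r hr =>
    left
    have e : d.app (a + j) = d.app a + j := by
      simp only [AffineGroup.app]; linear_combination unitStab'_mul_right d.right.2
    simpa only [affineMap, e] using SubdivArc.last (d.app a) r hr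

/-- The extension of `ℤ/2j ⋊ H'` to automorphisms of `C_{2j}(i, j_÷p)`. -/
def affineAut (i j p : ℕ) : AffineGroup (2 * j) i j →*
    (subdivCirculant (2 * j) i j p ≃g subdivCirculant (2 * j) i j p) where
  toFun d := autOfArc (affinePerm d) (affineMap_arc d) (affineMap_arc d⁻¹)
  map_one' := by
    apply RelIso.ext
    rintro (a | ⟨a, r⟩)
    · exact congrArg SubdivVertex.u (AffineGroup.app_one a)
    · exact congrArg (SubdivVertex.v · r) (AffineGroup.app_one a)
  map_mul' d e := by
    apply RelIso.ext
    rintro (a | ⟨a, r⟩)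
    · exact congrArg SubdivVertex.u (AffineGroup.app_mul d e a)
    · exact congrArg (SubdivVertex.v · r) (AffineGroup.app_mul d e a)

open Classical in
/-- The flip of the two subdivided paths between `u_a` and `u_{a+j}`: `v_b^r ↦ v_{b+j}^{p+1-r}` for
`b ∈ {a, a + j}`, all other vertices being fixed. -/
noncomputable def flipMap {j p : ℕ} (a : ZMod (2 * j)) :
    SubdivVertex (2 * j) p → SubdivVertex (2 * j) p
  | .u b => .u b
  | .v b r => if b = a ∨ b = a + (j : ZMod (2 * j)) then .v (b + (j : ZMod (2 * j))) r.rev else .v b r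

theorem flip_cond {j : ℕ} (a b : ZMod (2 * j)) :
    (b + (j : ZMod (2 * j)) = a ∨ b + (j : ZMod (2 * j)) = a + (j : ZMod (2 * j))) ↔
      (b = a ∨ b = a + (j : ZMod (2 * j))) := by
  have h := two_mul_cast_self j
  constructor
  · rintro (e | e)
    · right; linear_combination e - h
    · left; linear_combination e
  · rintro (e | e)
    · right; linear_combination e
    · left; linear_combination e + h

theorem flipMap_flipMap {j p : ℕ} (a : ZMod (2 * j)) (x : SubdivVertex (2 * j) p) :
    flipMap a (flipMap a x) = x := by
  rcases x with b | ⟨b, r⟩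
  · rfl
  · by_cases hb : b = a ∨ b = a + (j : ZMod (2 * j))
    · have hb' := (flip_cond a b).2 hb
      simp only [flipMap, if_pos hb, if_pos hb', Fin.rev_rev]
      rw [add_assoc, two_mul_cast_self, add_zero]
    · simp only [flipMap, if_neg hb]

/-- The permutation of the vertices given by the flip. -/
noncomputable def flipPerm {j p : ℕ} (a : ZMod (2 * j)) : Equiv.Perm (SubdivVertex (2 * j) p) where
  toFun := flipMap a
  invFun := flipMap a
  left_inv := flipMap_flipMap a
  right_inv := flipMap_flipMap a

theorem flipMap_arc {i j p : ℕ} (a : ZMod (2 * j)) (x y : SubdivVertex (2 * j) p)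
    (h : SubdivArc (2 * j) i j p x y) :
    SubdivArc (2 * j) i j p (flipMap a x) (flipMap a y) ∨
      SubdivArc (2 * j) i j p (flipMap a y) (flipMap a x) := by
  cases h with
  | circ b => exact Or.inl (SubdivArc.circ b)
  | first b r hr =>
    by_cases hb : b = a ∨ b = a + (j : ZMod (2 * j))
    · right
      have := SubdivArc.last (n := 2 * j) (i := i) (j := j) (b + (j : ZMod (2 * j))) r.rev
        (by have := r.2; simp only [Fin.val_rev]; omega)
      rw [add_assoc, two_mul_cast_self, add_zero] at this
      simpa only [flipMap, if_pos hb] using this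
    · left
      simpa only [flipMap, if_neg hb] using SubdivArc.first b r hr
  | next b r r' hr =>
    by_cases hb : b = a ∨ b = a + (j : ZMod (2 * j))
    · right
      simpa only [flipMap, if_pos hb] using
        SubdivArc.next (b + (j : ZMod (2 * j))) r'.rev r.rev
          (by have := r.2; have := r'.2; simp only [Fin.val_rev]; omega)
    · left
      simpa only [flipMap, if_neg hb] using SubdivArc.next b r r' hr
  | last b r hr =>
    by_cases hb : b = a ∨ b = a + (j : ZMod (2 * j))
    · right
      simpa only [flipMap, if_pos hb] using
        SubdivArc.first (b + (j : ZMod (2 * j))) r.rev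
          (by have := r.2; simp only [Fin.val_rev]; omega)
    · left
      simpa only [flipMap, if_neg hb] using SubdivArc.last b r hr

/-- The flip automorphism `β_a` of `C_{2j}(i, j_÷p)`. -/
noncomputable def flipAut (i j p : ℕ) (a : ZMod (2 * j)) :
    subdivCirculant (2 * j) i j p ≃g subdivCirculant (2 * j) i j p :=
  autOfArc (flipPerm a) (flipMap_arc a) (flipMap_arc a)

/-- The subgroup `B = ⟨β_a | 0 ≤ a < j⟩` of the automorphism group. -/
noncomputable def flipSubgroup (i j p : ℕ) :
    Subgroup (subdivCirculant (2 * j) i j p ≃g subdivCirculant (2 * j) i j p) :=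
  Subgroup.closure (Set.range fun k : Fin j => flipAut i j p ((k : ℕ) : ZMod (2 * j)))

/-! Inner path vertices have at most two neighbours, while `u_a` has at least three, so
automorphisms permute the `u_a` (`aut_u_eq`). Because `2j = 0`, exactly two subdivided paths meet
`u_a`, and both lead to `u_{a+j}`; hence the induced map on `ℤ/2j` commutes with translation by `j`
(`aut_path`). It also sends differences `±i` to differences `±i`, and as `i` and `j` generate
`ℤ/2j`, it is affine of slope `±1` (`affine_of_injective`).

Dividing by this affine map leaves an automorphism fixing every `u_a`. It fixes or swaps the two
paths between `u_a` and `u_{a+j}`, independently for the `j` such pairs. So `B` is the pointwise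
stabilizer of the `u_a` (`mem_flipSubgroup_iff`): it is normal, isomorphic to `(ℤ/2)^j`, and
complemented by the affine group, which acts faithfully on the `u_a`. -/

/-! ### Periodic functions and affine maps on `ℤ/2j` -/

theorem ZMod.periodic_one_of_coprime {n i j : ℕ} (h : Nat.Coprime i j) {X : Type*}
    {f : ZMod n → X} (hi : Function.Periodic f i) (hj : Function.Periodic f j) :
    Function.Periodic f 1 := by
  have h1 : (1 : ZMod n) = Nat.gcdA i j • (i : ZMod n) + Nat.gcdB i j • (j : ZMod n) := by
    have e := congrArg (Int.cast (R := ZMod n)) (Nat.gcd_eq_gcd_ab i j)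
    rw [h.gcd_eq_one] at e
    push_cast at e
    simp only [zsmul_eq_mul]
    linear_combination e
  rw [h1]
  exact (hi.zsmul _).add_period (hj.zsmul _)

/-- The classes of two coprime numbers generate `ℤ/n`. -/
theorem ZMod.eq_apply_zero_of_periodic {n i j : ℕ} (h : Nat.Coprime i j) {X : Type*}
    {f : ZMod n → X} (hi : Function.Periodic f i) (hj : Function.Periodic f j) (a : ZMod n) :
    f a = f 0 := by
  obtain ⟨z, rfl⟩ := ZMod.intCast_surjective a
  simpa using ((ZMod.periodic_one_of_coprime h hi hj).zsmul z).eq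

theorem cast_ne_zero_of_pos_of_lt {i j : ℕ} (hi : 0 < i) (hij : i < 2 * j) :
    (i : ZMod (2 * j)) ≠ 0 := by
  rw [Ne, ZMod.natCast_eq_zero_iff]
  exact fun h => absurd (Nat.le_of_dvd hi h) (by omega)

theorem cast_add_cast_ne_zero {i j : ℕ} (hi : 0 < i) (hij : i < j) :
    (i : ZMod (2 * j)) + i ≠ 0 := by
  have := cast_ne_zero_of_pos_of_lt (i := i + i) (j := j) (by omega) (by omega)
  push_cast at this
  exact this

/-- An injective map of `ℤ/2j` that commutes with the translation by `j` and maps differences `±i`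
to differences `±i` is affine of slope `±1`. -/
theorem affine_of_injective {i j : ℕ} (hi : 0 < i) (hij : i < j) (h : Nat.Coprime i j)
    {f : ZMod (2 * j) → ZMod (2 * j)} (hf : Function.Injective f)
    (hfj : ∀ a, f (a + j) = f a + j)
    (hfi : ∀ a, f (a + i) = f a + i ∨ f a = f (a + i) + i) :
    (∀ a, f a = f 0 + a) ∨ ∀ a, f a = f 0 - a := by
  -- The increment along `i` is constant: a change of sign would give `f (a + 2i) = f a`, against
  -- injectivity since `2i ≠ 0`.
  have hg : ∀ a, f (a + i) - f a = f (0 + i) - f 0 := by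
    intro a
    refine ZMod.eq_apply_zero_of_periodic (f := fun a : ZMod (2 * j) => f (a + i) - f a) h
      (fun a => ?_) (fun a => ?_) a
    · have hne : f (a + i + i) ≠ f a := fun e => cast_add_cast_ne_zero hi hij (by
        linear_combination hf e)
      rcases hfi a with e | e <;> rcases hfi (a + i) with e' | e'
      · linear_combination e' - e
      · exact absurd (by linear_combination e - e') hne
      · exact absurd (by linear_combination e' - e) hne
      · linear_combination e - e'
    · have := hfj (a + i)
      rw [add_right_comm] at this
      linear_combination this - hfj a
  rcases hfi 0 with e | e
  · left
    intro a
    have := ZMod.eq_apply_zero_of_periodic (f := fun a => f a - a) h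
      (fun a => by linear_combination hg a + e) (fun a => by linear_combination hfj a) a
    linear_combination this
  · right
    intro a
    have := ZMod.eq_apply_zero_of_periodic (f := fun a => f a + a) h
      (fun a => by linear_combination hg a - e)
      (fun a => by linear_combination hfj a + two_mul_cast_self j) a
    linear_combination this

/-! ### The group `H'` -/

theorem neg_one_mem_unitStab' (n i j : ℕ) : (-1 : (ZMod n)ˣ) ∈ unitStab' n i j := by
  refine ⟨MulAction.mem_stabilizer_iff.2 ?_, MulAction.mem_stabilizer_iff.2 ?_,
    MulAction.mem_stabilizer_iff.2 ?_⟩ <;> ext x <;> simp [Units.smul_def] <;> grind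

/-- Since `-j = j`, `t` fixes `j`. If `ti = ±i`, the function `a ↦ ta ∓ a` has periods `i` and `j`,
so it takes the same value at `1` as at `0`. -/
theorem unitStab'_eq {i j : ℕ} (h : Nat.Coprime i j) {t : (ZMod (2 * j))ˣ}
    (ht : t ∈ unitStab' (2 * j) i j) : t = 1 ∨ t = -1 := by
  have hj := unitStab'_mul_right ht
  refine (unitStab'_mul_left ht).imp (fun hi => Units.ext ?_) fun hi => Units.ext ?_
  · have := ZMod.eq_apply_zero_of_periodic (f := fun a => (t : ZMod (2 * j)) * a - a) h
      (fun a => by linear_combination hi) (fun a => by linear_combination hj) 1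
    simp only [Units.val_one]
    linear_combination this
  · have := ZMod.eq_apply_zero_of_periodic (f := fun a => (t : ZMod (2 * j)) * a + a) h
      (fun a => by linear_combination hi)
      (fun a => by linear_combination hj + two_mul_cast_self j) 1
    simp only [Units.val_neg, Units.val_one]
    linear_combination this

theorem coe_unitStab' {i j : ℕ} (h : Nat.Coprime i j) :
    (unitStab' (2 * j) i j : Set (ZMod (2 * j))ˣ) = {1, -1} := by
  ext t
  refine ⟨unitStab'_eq h, ?_⟩
  rintro (rfl | rfl)
  · exact one_mem _
  · exact neg_one_mem_unitStab' _ _ _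

/-! The isomorphism of `ℤ/2j ⋊ H'` with the dihedral group. -/

theorem one_ne_neg_one_units {j : ℕ} (hj : 1 < j) : (-1 : (ZMod (2 * j))ˣ) ≠ 1 := by
  intro h
  have h1 := congrArg (Units.val) h
  have := cast_add_cast_ne_zero (i := 1) (j := j) one_pos hj
  simp only [Units.val_neg, Units.val_one] at h1
  exact this (by push_cast; linear_combination -h1)

open Classical in
/-- The homomorphism of `ℤ/2j ⋊ H'` to the dihedral group: `(s, 1) ↦ r^s`, `(s, -1) ↦ r^s · sr 0`. -/
noncomputable def affineToDihedral {i j : ℕ} (hj : 1 < j) (h : Nat.Coprime i j) :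
    AffineGroup (2 * j) i j →* DihedralGroup (2 * j) where
  -- The sign in the reflection comes from the convention `r s * sr 0 = sr (0 - s)`.
  toFun d := if (d.right : (ZMod (2 * j))ˣ) = 1 then .r (Multiplicative.toAdd d.left)
    else .sr (-Multiplicative.toAdd d.left)
  map_one' := by simp
  map_mul' d e := by
    have hne := one_ne_neg_one_units hj
    have key : Multiplicative.toAdd (d * e).left = Multiplicative.toAdd d.left +
        ((d.right : (ZMod (2 * j))ˣ) : ZMod (2 * j)) * Multiplicative.toAdd e.left := by
      simp [unitAction]; rfl
    rw [key]
    simp only [SemidirectProduct.mul_right, Subgroup.coe_mul]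
    rcases unitStab'_eq h d.right.2 with hd | hd <;> rcases unitStab'_eq h e.right.2 with he | he <;>
      simp [hd, he, hne] <;> ring

theorem affineToDihedral_bijective {i j : ℕ} (hj : 1 < j) (h : Nat.Coprime i j) :
    Function.Bijective (affineToDihedral hj h) := by
  have hne := one_ne_neg_one_units hj
  constructor
  · intro d e hde
    simp only [affineToDihedral, MonoidHom.coe_mk, OneHom.coe_mk] at hde
    rcases unitStab'_eq h d.right.2 with hd | hd <;>
      rcases unitStab'_eq h e.right.2 with he | he <;> simp [hd, he, hne] at hde
    · exact SemidirectProduct.ext hde (Subtype.ext (hd.trans he.symm))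
    · exact SemidirectProduct.ext hde (Subtype.ext (hd.trans he.symm))
  · rintro (s | s)
    · exact ⟨⟨Multiplicative.ofAdd s, 1⟩, by simp [affineToDihedral]⟩
    · exact ⟨⟨Multiplicative.ofAdd (-s), ⟨-1, neg_one_mem_unitStab' _ _ _⟩⟩,
        by simp [affineToDihedral, hne]⟩

/-! ### Rigidity of the vertices `u_a` and of the subdivided paths -/

open SubdivVertex

theorem subdivCirculant_adj {n i j p : ℕ} {x y : SubdivVertex n p} :
    (subdivCirculant n i j p).Adj x y ↔
      x ≠ y ∧ (SubdivArc n i j p x y ∨ SubdivArc n i j p y x) :=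
  SimpleGraph.fromRel_adj _ _ _

/-- The `k`-th vertex of the path `(u_a, v_a^1, …, v_a^p, u_{a+j})`. -/
def pathVertex {j p : ℕ} (a : ZMod (2 * j)) (k : ℕ) : SubdivVertex (2 * j) p :=
  if k = 0 then u a else if h : k - 1 < p then v a ⟨k - 1, h⟩ else u (a + (j : ZMod (2 * j)))

section pathVertex

variable {i j p : ℕ}

theorem pathVertex_zero (a : ZMod (2 * j)) : (pathVertex a 0 : SubdivVertex (2 * j) p) = u a := rfl

theorem pathVertex_val_add_one (a : ZMod (2 * j)) (r : Fin p) : pathVertex a (r + 1) = v a r := by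
  simp [pathVertex]

theorem pathVertex_length (a : ZMod (2 * j)) :
    (pathVertex a (p + 1) : SubdivVertex (2 * j) p) = u (a + (j : ZMod (2 * j))) := by
  simp [pathVertex]

theorem adj_u_u {a b : ZMod (2 * j)} :
    (subdivCirculant (2 * j) i j p).Adj (u a) (u b) → b = a + i ∨ a = b + i := by
  rw [subdivCirculant_adj]
  rintro ⟨-, h | h⟩ <;> cases h
  · exact Or.inl rfl
  · exact Or.inr rfl

theorem adj_u_add (hi : (i : ZMod (2 * j)) ≠ 0) (a : ZMod (2 * j)) :
    (subdivCirculant (2 * j) i j p).Adj (u a) (u (a + i)) :=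
  subdivCirculant_adj.2 ⟨by simpa using hi, Or.inl (.circ a)⟩

theorem adj_u_v {a b : ZMod (2 * j)} {r : Fin p} :
    (subdivCirculant (2 * j) i j p).Adj (u a) (v b r) →
      (b = a ∧ (r : ℕ) = 0) ∨ (b = a + j ∧ (r : ℕ) + 1 = p) := by
  rw [subdivCirculant_adj]
  rintro ⟨-, h | h⟩ <;> cases h
  · exact Or.inl ⟨rfl, ‹_›⟩
  -- The path ending at `u_a` has index `a - j`, which is `a + j`.
  · exact Or.inr ⟨by rw [add_assoc, two_mul_cast_self, add_zero], ‹_›⟩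

theorem pathVertex_adj_succ (hp : 1 ≤ p) (a : ZMod (2 * j)) {k : ℕ} (hk : k ≤ p) :
    (subdivCirculant (2 * j) i j p).Adj (pathVertex a k) (pathVertex a (k + 1)) := by
  rw [subdivCirculant_adj]
  rcases k with _ | k
  · have h0 : 0 < p := hp
    simp only [pathVertex, if_true, zero_add, one_ne_zero, if_false, Nat.sub_self, dif_pos h0]
    exact ⟨by simp, Or.inl (.first a _ rfl)⟩
  · have h0 : k < p := hk
    by_cases h1 : k + 1 < p
    · simp only [pathVertex, Nat.add_sub_cancel, Nat.succ_ne_zero, if_false, dif_pos h0, dif_pos h1]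
      exact ⟨by simp, Or.inl (.next a _ _ rfl)⟩
    · simp only [pathVertex, Nat.add_sub_cancel, Nat.succ_ne_zero, if_false, dif_pos h0, dif_neg h1]
      exact ⟨by simp, Or.inl (.last a _ (by simp only; omega))⟩

/-- Paths do not backtrack. For `p = 1` the two vertices are the ends `u_a` and `u_{a+j}`, distinct
because `j ≠ 0` in `ℤ/2j`. -/
theorem pathVertex_ne_add_two (hj : 0 < j) (a : ZMod (2 * j)) {k : ℕ} (hk : k + 1 ≤ p) :
    (pathVertex a k : SubdivVertex (2 * j) p) ≠ pathVertex a (k + 2) := by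
  have hj0 := cast_ne_zero_of_pos_of_lt hj (by omega : j < 2 * j)
  simp only [pathVertex]
  split_ifs <;> simp_all
  omega

/-- An inner vertex of a subdivided path has at most two neighbours. -/
theorem eq_of_adj_pathVertex_succ {a : ZMod (2 * j)} {k : ℕ} (hk : k < p)
    {x : SubdivVertex (2 * j) p}
    (h : (subdivCirculant (2 * j) i j p).Adj (pathVertex a (k + 1)) x) :
    x = pathVertex a k ∨ x = pathVertex a (k + 2) := by
  rw [← Fin.val_mk hk, pathVertex_val_add_one, subdivCirculant_adj] at h
  obtain ⟨-, h | h⟩ := h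
  · right
    cases h with
    | next _ _ r' hr =>
      rw [← pathVertex_val_add_one, hr]
    | last _ _ hr =>
      rw [← pathVertex_length, ← hr]
  · left
    cases h with
    | first _ _ hr =>
      simp only at hr
      rw [hr, pathVertex_zero]
    | next _ r _ hr =>
      simp only at hr
      rw [hr, pathVertex_val_add_one]

/-- Pigeonhole: `u_{a+i}`, `u_{a-i}` and `v_a^1` are three distinct neighbours of `u_a` (as `2i ≠
0`), too many for an inner path vertex. -/
theorem aut_u_eq (hi : 0 < i) (hij : i < j) (hp : 1 ≤ p)
    (φ : subdivCirculant (2 * j) i j p ≃g subdivCirculant (2 * j) i j p) (a : ZMod (2 * j)) :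
    ∃ b, φ (u a) = u b := by
  rcases hx : φ (u a) with b | ⟨b, r⟩
  · exact ⟨b, rfl⟩
  exfalso
  have hi0 := cast_ne_zero_of_pos_of_lt hi (by omega : i < 2 * j)
  have hii := cast_add_cast_ne_zero hi hij
  rw [← pathVertex_val_add_one] at hx
  have key : ∀ y, (subdivCirculant (2 * j) i j p).Adj (u a) y →
      φ y = pathVertex b r ∨ φ y = pathVertex b (r + 2) := fun y hy =>
    eq_of_adj_pathVertex_succ (i := i) r.2 (hx ▸ φ.map_adj_iff.2 hy)
  have h1 := key _ (adj_u_add hi0 a)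
  have h2 := key (u (a - i)) (by simpa using (adj_u_add (p := p) hi0 (a - i)).symm)
  have h3 := key _ (pathVertex_adj_succ hp a (Nat.zero_le p))
  have n12 : φ (u (a + i)) ≠ φ (u (a - i)) := fun e => by
    have := u.inj (φ.injective e)
    exact hii (by linear_combination this)
  have hv : (pathVertex a (0 + 1) : SubdivVertex (2 * j) p) = v a ⟨0, hp⟩ :=
    pathVertex_val_add_one a ⟨0, hp⟩
  have n13 : φ (u (a + i)) ≠ φ (pathVertex a (0 + 1)) := fun e => by
    have := φ.injective e
    rw [hv] at this
    cases this
  have n23 : φ (u (a - i)) ≠ φ (pathVertex a (0 + 1)) := fun e => by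
    have := φ.injective e
    rw [hv] at this
    cases this
  grind

/-- An automorphism is determined along a subdivided path by the images of its first arc. -/
theorem aut_pathVertex (hj : 0 < j) (hp : 1 ≤ p)
    {φ : subdivCirculant (2 * j) i j p ≃g subdivCirculant (2 * j) i j p} {a b : ZMod (2 * j)}
    (h0 : φ (pathVertex a 0) = pathVertex b 0) (h1 : φ (pathVertex a 1) = pathVertex b 1)
    (k : ℕ) (hk : k ≤ p) :
    φ (pathVertex a k) = pathVertex b k ∧ φ (pathVertex a (k + 1)) = pathVertex b (k + 1) := by
  induction k with
  | zero => exact ⟨h0, h1⟩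
  | succ k ih =>
    obtain ⟨e0, e1⟩ := ih (by omega)
    refine ⟨e1, ?_⟩
    have := φ.map_adj_iff.2 (pathVertex_adj_succ (i := i) hp a hk)
    rw [e1] at this
    -- The other neighbour is already the image of the `k`-th vertex.
    refine (eq_of_adj_pathVertex_succ hk this).resolve_left fun e => ?_
    rw [← e0] at e
    exact pathVertex_ne_add_two hj a hk (φ.injective e).symm

theorem flipAut_v_of_eq {a b : ZMod (2 * j)} (h : b = a ∨ b = a + (j : ZMod (2 * j))) (r : Fin p) :
    flipAut i j p a (v b r) = v (b + (j : ZMod (2 * j))) r.rev := if_pos h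

theorem flipAut_v_of_ne {a b : ZMod (2 * j)} (h : ¬ (b = a ∨ b = a + (j : ZMod (2 * j))))
    (r : Fin p) : flipAut i j p a (v b r) = v b r := if_neg h

theorem add_self_cast (b : ZMod (2 * j)) : b + (j : ZMod (2 * j)) + (j : ZMod (2 * j)) = b := by
  rw [add_assoc, two_mul_cast_self, add_zero]

theorem aut_path_of_first (hj : 0 < j) (hp : 1 ≤ p)
    {φ : subdivCirculant (2 * j) i j p ≃g subdivCirculant (2 * j) i j p} {a b : ZMod (2 * j)}
    (h0 : φ (u a) = u b) (h1 : φ (v a ⟨0, hp⟩) = v b ⟨0, hp⟩) :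
    φ (u (a + (j : ZMod (2 * j)))) = u (b + (j : ZMod (2 * j))) ∧ ∀ r, φ (v a r) = v b r := by
  have h1' : φ (pathVertex a 1) = pathVertex b 1 := by
    simpa only [← pathVertex_val_add_one] using h1
  have key := aut_pathVertex hj hp (φ := φ) (a := a) (b := b) h0 h1'
  constructor
  · simpa only [pathVertex_length] using (key p le_rfl).2
  · intro r
    simpa only [pathVertex_val_add_one] using (key r r.2.le).2

theorem aut_path (hi : 0 < i) (hij : i < j) (hp : 1 ≤ p)
    {φ : subdivCirculant (2 * j) i j p ≃g subdivCirculant (2 * j) i j p} {a b : ZMod (2 * j)}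
    (h0 : φ (u a) = u b) :
    φ (u (a + (j : ZMod (2 * j)))) = u (b + (j : ZMod (2 * j))) ∧
      ((∀ r, φ (v a r) = v b r) ∨ ∀ r, φ (v a r) = v (b + (j : ZMod (2 * j))) r.rev) := by
  have hadj : (subdivCirculant (2 * j) i j p).Adj (u a) (v a ⟨0, hp⟩) :=
    subdivCirculant_adj.2 ⟨by simp, Or.inl (.first a _ rfl)⟩
  have hadj' := φ.map_adj_iff.2 hadj
  rw [h0] at hadj'
  rcases hx : φ (v a ⟨0, hp⟩) with c | ⟨c, r⟩
  -- The inverse also preserves the `u`-vertices, so no `v`-vertex is sent to one.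
  · obtain ⟨d, hd⟩ := aut_u_eq hi hij hp φ⁻¹ c
    rw [← hx, RelIso.inv_apply_self] at hd
    cases hd
  rw [hx] at hadj'
  rcases adj_u_v hadj' with ⟨rfl, hr⟩ | ⟨rfl, hr⟩
  · have := aut_path_of_first (by omega) hp h0 (by rw [hx]; congr 1; exact Fin.ext hr)
    exact ⟨this.1, Or.inl this.2⟩
  -- Composing with the flip at `b` reduces to the previous case.
  · have h1 : (flipAut i j p b * φ) (v a ⟨0, hp⟩) = v b ⟨0, hp⟩ := by
      rw [RelIso.mul_apply, hx, flipAut_v_of_eq (Or.inr rfl), add_self_cast]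
      congr 1
      apply Fin.ext
      simp only [Fin.val_rev]
      omega
    obtain ⟨hu, hv⟩ := aut_path_of_first (a := a) (b := b) (φ := flipAut i j p b * φ) (by omega) hp
      (by rw [RelIso.mul_apply, h0]; rfl) h1
    have inv : ∀ x y, flipAut i j p b x = y → x = flipAut i j p b y := fun x y e => by
      rw [← e]; exact (flipMap_flipMap b x).symm
    refine ⟨inv _ _ hu, Or.inr fun r => ?_⟩
    exact (inv _ _ (hv r)).trans (flipAut_v_of_eq (Or.inl rfl) r)

/-- Every automorphism acts on the vertices `u_a` like an element of `ℤ/2j ⋊ H'`. -/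
theorem exists_affineAut_u (hi : 0 < i) (hij : i < j) (h : Nat.Coprime i j) (hp : 1 ≤ p)
    (φ : subdivCirculant (2 * j) i j p ≃g subdivCirculant (2 * j) i j p) :
    ∃ d : AffineGroup (2 * j) i j, ∀ a, φ (u a) = affineAut i j p d (u a) := by
  choose f hf using aut_u_eq hi hij hp φ
  have hinj : Function.Injective f := fun a b e => by
    have := (hf a).trans ((congrArg u e).trans (hf b).symm)
    exact u.inj (φ.injective this)
  have hfj : ∀ a, f (a + j) = f a + j := fun a => by
    have := (aut_path hi hij hp (hf a)).1
    rw [hf] at this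
    exact u.inj this
  have hfi : ∀ a, f (a + i) = f a + i ∨ f a = f (a + i) + i := fun a => by
    have := φ.map_adj_iff.2
      (adj_u_add (p := p) (cast_ne_zero_of_pos_of_lt hi (by omega : i < 2 * j)) a)
    rw [hf, hf] at this
    exact adj_u_u this
  rcases affine_of_injective hi hij h hinj hfj hfi with e | e
  · refine ⟨⟨Multiplicative.ofAdd (f 0), 1⟩, fun a => ?_⟩
    rw [hf, e]
    exact congrArg u (by simp [AffineGroup.app])
  · refine ⟨⟨Multiplicative.ofAdd (f 0), ⟨-1, neg_one_mem_unitStab' _ _ _⟩⟩, fun a => ?_⟩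
    rw [hf, e]
    exact congrArg u (by simp [AffineGroup.app, sub_eq_add_neg])

end pathVertex

/-! ### Independent flips and the group `B` -/

section flips

variable {i j p : ℕ}

/-- The residue modulo `j` of an element of `ℤ/2j`. -/
def residue [NeZero j] (b : ZMod (2 * j)) : Fin j := Fin.ofNat j b.val

theorem cast_residue [NeZero j] (b : ZMod (2 * j)) :
    b = ((residue b : ℕ) : ZMod (2 * j)) ∨ b = ((residue b : ℕ) : ZMod (2 * j)) + j := by
  have hb : b.val < 2 * j := ZMod.val_lt b
  have hval : ((b.val : ℕ) : ZMod (2 * j)) = b := ZMod.natCast_zmod_val b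
  simp only [residue, Fin.val_ofNat]
  rcases lt_or_ge b.val j with h | h
  · rw [Nat.mod_eq_of_lt h, hval]
    exact Or.inl rfl
  · right
    rw [Nat.mod_eq_sub_mod h, Nat.mod_eq_of_lt (by omega), Nat.cast_sub h, hval, sub_add_cancel]

theorem residue_natCast [NeZero j] (k : Fin j) : residue ((k : ℕ) : ZMod (2 * j)) = k := by
  apply Fin.ext
  simp only [residue, Fin.val_ofNat, ZMod.val_natCast, Nat.mod_mul_left_mod]
  exact Nat.mod_eq_of_lt k.2

theorem residue_add_cast [NeZero j] (b : ZMod (2 * j)) :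
    residue (b + (j : ZMod (2 * j))) = residue b := by
  apply Fin.ext
  simp only [residue, Fin.val_ofNat, ZMod.val_add, Nat.mod_mul_left_mod, ZMod.val_natCast]
  simp [Nat.add_mod]

theorem residue_eq_iff [NeZero j] {b : ZMod (2 * j)} {k : Fin j} :
    residue b = k ↔ b = ((k : ℕ) : ZMod (2 * j)) ∨ b = ((k : ℕ) : ZMod (2 * j)) + j := by
  constructor
  · rintro rfl
    exact cast_residue b
  · rintro (rfl | rfl)
    · exact residue_natCast k
    · rw [residue_add_cast, residue_natCast]

/-- The flips of those pairs of subdivided paths at which `e` is nontrivial. -/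
def flipsMap [NeZero j] (e : Fin j → Multiplicative (ZMod 2)) :
    SubdivVertex (2 * j) p → SubdivVertex (2 * j) p
  | .u b => .u b
  | .v b r => if e (residue b) = 1 then .v b r else .v (b + (j : ZMod (2 * j))) r.rev

theorem eq_ofAdd_one_of_ne_one {x : Multiplicative (ZMod 2)} (h : x ≠ 1) :
    x = Multiplicative.ofAdd 1 := by
  revert x
  decide

theorem flipsMap_mul [NeZero j] (e e' : Fin j → Multiplicative (ZMod 2))
    (x : SubdivVertex (2 * j) p) : flipsMap (e * e') x = flipsMap e (flipsMap e' x) := by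
  rcases x with b | ⟨b, r⟩
  · rfl
  · by_cases h : e (residue b) = 1 <;> by_cases h' : e' (residue b) = 1
    · simp [flipsMap, h, h']
    · simp [flipsMap, h, h', residue_add_cast]
    · simp [flipsMap, h, h']
    · have : e (residue b) * e' (residue b) = 1 := by
        rw [eq_ofAdd_one_of_ne_one h, eq_ofAdd_one_of_ne_one h']; decide
      simp [flipsMap, h, h', residue_add_cast, this, add_self_cast]

theorem flipsMap_one [NeZero j] (x : SubdivVertex (2 * j) p) : flipsMap 1 x = x := by
  rcases x with b | ⟨b, r⟩ <;> simp [flipsMap]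

/-- Every arc off the `i`-arcs lies on a single path, where the map is either the identity or one
flip. -/
theorem flipsMap_arc [NeZero j] (e : Fin j → Multiplicative (ZMod 2))
    (x y : SubdivVertex (2 * j) p) (h : SubdivArc (2 * j) i j p x y) :
    SubdivArc (2 * j) i j p (flipsMap e x) (flipsMap e y) ∨
      SubdivArc (2 * j) i j p (flipsMap e y) (flipsMap e x) := by
  have hv : ∀ b (r : Fin p), e (residue b) ≠ 1 → flipsMap e (v b r) = flipMap b (v b r) :=
    fun b r hb => by simp [flipsMap, flipMap, hb]
  have hv1 : ∀ b (r : Fin p), e (residue b) = 1 → flipsMap e (v b r) = v b r :=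
    fun b r hb => by simp [flipsMap, hb]
  cases h with
  | circ b => exact Or.inl (.circ b)
  | first b r hr =>
    by_cases hb : e (residue b) = 1
    · rw [hv1 b r hb]
      exact Or.inl (.first b r hr)
    · rw [hv b r hb]
      exact flipMap_arc b _ _ (.first b r hr)
  | next b r r' hr =>
    by_cases hb : e (residue b) = 1
    · rw [hv1 b r hb, hv1 b r' hb]
      exact Or.inl (.next b r r' hr)
    · rw [hv b r hb, hv b r' hb]
      exact flipMap_arc b _ _ (.next b r r' hr)
  | last b r hr =>
    by_cases hb : e (residue b) = 1
    · rw [hv1 b r hb]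
      exact Or.inl (.last b r hr)
    · rw [hv b r hb]
      exact flipMap_arc b _ _ (.last b r hr)

/-- The permutation of the vertices given by a family of flips. -/
def flipsPerm [NeZero j] (e : Fin j → Multiplicative (ZMod 2)) :
    Equiv.Perm (SubdivVertex (2 * j) p) where
  toFun := flipsMap e
  invFun := flipsMap e⁻¹
  left_inv x := by rw [← flipsMap_mul, inv_mul_cancel, flipsMap_one]
  right_inv x := by rw [← flipsMap_mul, mul_inv_cancel, flipsMap_one]

/-- The action of `(ℤ/2)^j` by flips. -/
def flipsAut (i j p : ℕ) [NeZero j] : (Fin j → Multiplicative (ZMod 2)) →*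
    (subdivCirculant (2 * j) i j p ≃g subdivCirculant (2 * j) i j p) where
  toFun e := autOfArc (flipsPerm e) (flipsMap_arc e) (flipsMap_arc e⁻¹)
  map_one' := RelIso.ext flipsMap_one
  map_mul' e e' := RelIso.ext (flipsMap_mul e e')

theorem flipsAut_mulSingle [NeZero j] (k : Fin j) :
    flipsAut i j p (Pi.mulSingle k (Multiplicative.ofAdd 1)) =
      flipAut i j p ((k : ℕ) : ZMod (2 * j)) := by
  apply RelIso.ext
  rintro (b | ⟨b, r⟩)
  · rfl
  · change flipsMap (Pi.mulSingle k (Multiplicative.ofAdd 1)) (v b r) = flipMap _ (v b r)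
    by_cases h : residue b = k
    · have h' := residue_eq_iff.1 h
      simp only [flipsMap, flipMap, if_pos h', h, Pi.mulSingle_eq_same]
      rw [if_neg (by decide)]
    · have h' := mt residue_eq_iff.2 h
      simp only [flipsMap, flipMap, if_neg h', Pi.mulSingle_eq_of_ne h, if_true]

/-- A flip is seen from the index alone, as `k + j ≠ k`; this also covers `p = 1`, where reversal is
trivial. -/
theorem flipsAut_injective [NeZero j] (hp : 1 ≤ p) : Function.Injective (flipsAut i j p) := by
  rw [injective_iff_map_eq_one]
  intro e he
  funext k
  by_contra h
  have hj0 := cast_ne_zero_of_pos_of_lt (NeZero.pos j) (by have := NeZero.pos j; omega : j < 2 * j)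
  have := DFunLike.congr_fun he (v ((k : ℕ) : ZMod (2 * j)) ⟨0, hp⟩)
  change flipsMap e (v ((k : ℕ) : ZMod (2 * j)) ⟨0, hp⟩) = v _ _ at this
  simp only [flipsMap, residue_natCast] at this
  rw [if_neg (show ¬ e k = 1 from h)] at this
  have := (v.inj this).1
  exact hj0 (by simpa using this)

theorem range_flipsAut [NeZero j] : (flipsAut i j p).range = flipSubgroup i j p := by
  apply le_antisymm
  · rintro _ ⟨e, rfl⟩
    refine Subgroup.pi_mem_of_mulSingle_mem (H := (flipSubgroup i j p).comap (flipsAut i j p)) e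
      fun k => ?_
    by_cases h : e k = 1
    · rw [h, Pi.mulSingle_one]
      exact one_mem _
    · rw [eq_ofAdd_one_of_ne_one h, Subgroup.mem_comap, flipsAut_mulSingle]
      exact Subgroup.subset_closure ⟨k, rfl⟩
  · rw [flipSubgroup, Subgroup.closure_le]
    rintro _ ⟨k, rfl⟩
    exact ⟨_, flipsAut_mulSingle k⟩

/-- The flips generate the pointwise stabilizer of the vertices `u_a`. -/
theorem mem_flipSubgroup_iff (hi : 0 < i) (hij : i < j) (hp : 1 ≤ p)
    {φ : subdivCirculant (2 * j) i j p ≃g subdivCirculant (2 * j) i j p} :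
    φ ∈ flipSubgroup i j p ↔ ∀ a, φ (u a) = u a := by
  have : NeZero j := ⟨by omega⟩
  rw [← range_flipsAut]
  constructor
  · rintro ⟨e, rfl⟩ a
    rfl
  · intro h
    classical
    have hj0 := cast_ne_zero_of_pos_of_lt (i := j) (j := j) (by omega) (by omega)
    -- `S` marks the paths fixed pointwise. By injectivity the paths at `a` and `a + j` are fixed or
    -- swapped together, so `S` descends to residues modulo `j`.
    let S : ZMod (2 * j) → Prop := fun a => ∀ r, φ (v a r) = v a r
    have hS : ∀ a, ¬ S a → ∀ r, φ (v a r) = v (a + (j : ZMod (2 * j))) r.rev := fun a ha =>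
      (aut_path hi hij hp (h a)).2.resolve_left ha
    have hSj' : ∀ a, ¬ S a → ¬ S (a + (j : ZMod (2 * j))) := fun a ha ha' => by
      have := φ.injective ((hS a ha ⟨0, hp⟩).trans (ha' _).symm)
      exact hj0 (by simpa using (v.inj this).1)
    have hSj : ∀ a, S (a + (j : ZMod (2 * j))) ↔ S a := fun a => by
      refine ⟨fun ha => by_contra fun hn => hSj' a hn ha, fun ha => by_contra fun hn => ?_⟩
      have := hSj' _ hn
      rw [add_self_cast] at this
      exact this ha
    let e : Fin j → Multiplicative (ZMod 2) := fun k =>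
      if S ((k : ℕ) : ZMod (2 * j)) then 1 else Multiplicative.ofAdd 1
    refine ⟨e, ?_⟩
    apply RelIso.ext
    rintro (b | ⟨b, r⟩)
    · exact (h b).symm
    · have hb : S ((residue b : ℕ) : ZMod (2 * j)) ↔ S b := by
        rcases cast_residue b with e | e
        · rw [← e]
        · conv_rhs => rw [e]
          exact (hSj _).symm
      change flipsMap e (v b r) = _
      by_cases hbS : S b
      · simp only [e, flipsMap, if_pos (hb.2 hbS), if_true]
        exact (hbS r).symm
      · simp only [e, flipsMap, if_neg (mt hb.1 hbS)]
        rw [if_neg (by decide)]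
        exact (hS b hbS r).symm

/-- The pointwise stabilizer of an invariant set is normal. -/
theorem normal_flipSubgroup (hi : 0 < i) (hij : i < j) (hp : 1 ≤ p) :
    (flipSubgroup i j p).Normal := by
  refine ⟨fun β hβ φ => ?_⟩
  rw [mem_flipSubgroup_iff hi hij hp] at hβ ⊢
  intro a
  obtain ⟨b, hb⟩ := aut_u_eq hi hij hp φ⁻¹ a
  rw [RelIso.mul_apply, RelIso.mul_apply, hb, hβ, ← hb, RelIso.apply_inv_self]

/-! ### The semidirect decomposition -/

theorem app_add_cast (d : AffineGroup (2 * j) i j) (b : ZMod (2 * j)) :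
    d.app (b + j) = d.app b + j := by
  simp only [AffineGroup.app]
  linear_combination unitStab'_mul_right d.right.2

theorem app_injective (d : AffineGroup (2 * j) i j) : Function.Injective d.app := fun a b e => by
  have := congrArg d⁻¹.app e
  simpa [← AffineGroup.app_mul, AffineGroup.app_one] using this

/-- An affine map commutes with translation by `j`, so it carries the pair `{a, a + j}` to the pair
of its image; this yields the conjugation action on flips. -/
theorem affineAut_mul_flipAut (d : AffineGroup (2 * j) i j) (a : ZMod (2 * j)) :
    affineAut i j p d * flipAut i j p a = flipAut i j p (d.app a) * affineAut i j p d := by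
  apply RelIso.ext
  rintro (b | ⟨b, r⟩)
  · rfl
  · have hd : ∀ c r, affineAut i j p d (v c r) = v (d.app c) r := fun _ _ => rfl
    have hiff : (d.app b = d.app a ∨ d.app b = d.app a + (j : ZMod (2 * j))) ↔
        (b = a ∨ b = a + (j : ZMod (2 * j))) := by
      rw [← app_add_cast, (app_injective d).eq_iff, (app_injective d).eq_iff]
    rw [RelIso.mul_apply, RelIso.mul_apply, hd]
    by_cases h : b = a ∨ b = a + (j : ZMod (2 * j))
    · rw [flipAut_v_of_eq h, flipAut_v_of_eq (hiff.2 h), hd, app_add_cast]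
    · rw [flipAut_v_of_ne h, flipAut_v_of_ne (mt hiff.1 h), hd]

theorem eq_one_of_app_eq {d : AffineGroup (2 * j) i j} (h : ∀ a, d.app a = a) : d = 1 := by
  have h0 : Multiplicative.toAdd d.left = 0 := by simpa [AffineGroup.app] using h 0
  have h1 : ((d.right : (ZMod (2 * j))ˣ) : ZMod (2 * j)) = 1 := by
    simpa [AffineGroup.app, h0] using h 1
  exact SemidirectProduct.ext h0 (Subtype.ext (Units.ext h1))

/-- The action of `ℤ/2j ⋊ H'` on the group of flips by conjugation. -/
noncomputable def affineConj (i j p : ℕ) [(flipSubgroup i j p).Normal] :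
    AffineGroup (2 * j) i j →* MulAut (flipSubgroup i j p) :=
  MulAut.conjNormal.comp (affineAut i j p)

/-- The homomorphism `(β, (s, t)) ↦ β ∘ (s, t)`. -/
noncomputable def flipAffineHom (i j p : ℕ) [(flipSubgroup i j p).Normal] :
    flipSubgroup i j p ⋊[affineConj i j p] AffineGroup (2 * j) i j →*
      (subdivCirculant (2 * j) i j p ≃g subdivCirculant (2 * j) i j p) :=
  SemidirectProduct.lift (flipSubgroup i j p).subtype (affineAut i j p) fun d => by
    ext β : 1
    simp [affineConj, MulAut.conjNormal_apply]

/-- The restriction to the `u_a` determines the affine factor, and what remains fixes every `u_a`,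
so it lies in `B`. -/
theorem flipAffineHom_bijective (hi : 0 < i) (hij : i < j) (h : Nat.Coprime i j) (hp : 1 ≤ p)
    [(flipSubgroup i j p).Normal] : Function.Bijective (flipAffineHom i j p) := by
  constructor
  · rw [injective_iff_map_eq_one]
    rintro ⟨⟨β, hβ⟩, d⟩ hx
    change β * affineAut i j p d = 1 at hx
    have hd : d = 1 := eq_one_of_app_eq fun a => by
      have := DFunLike.congr_fun hx (u a)
      change β (u (d.app a)) = u a at this
      rw [(mem_flipSubgroup_iff hi hij hp).1 hβ] at this
      exact u.inj this
    subst hd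
    rw [map_one, mul_one] at hx
    subst hx
    rfl
  · intro φ
    obtain ⟨d, hd⟩ := exists_affineAut_u hi hij h hp φ
    refine ⟨⟨⟨φ * (affineAut i j p d)⁻¹, (mem_flipSubgroup_iff hi hij hp).2 fun a => ?_⟩, d⟩, ?_⟩
    · have ha : (affineAut i j p d)⁻¹ (u a) = u (d⁻¹.app a) := by
        rw [← map_inv]
        rfl
      rw [RelIso.mul_apply, ha, hd, ← ha, RelIso.apply_inv_self]
    · exact inv_mul_cancel_right _ _

end flips

theorem mainTheorem4 (i j p : ℕ) (hi : 0 < i) (hij : i < j)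
    (hgcd : Nat.gcd (Nat.gcd (2 * j) i) j = 1) (hp : 1 ≤ p) :
    (unitStab' (2 * j) i j : Set (ZMod (2 * j))ˣ) = {1, -1} ∧
    (flipSubgroup i j p).Normal ∧
    ∃ (ψ : AffineGroup (2 * j) i j →* MulAut (flipSubgroup i j p))
      (Φ : flipSubgroup i j p ⋊[ψ] AffineGroup (2 * j) i j ≃*
        (subdivCirculant (2 * j) i j p ≃g subdivCirculant (2 * j) i j p))
      (ε : (Fin j → Multiplicative (ZMod 2)) ≃* flipSubgroup i j p)
      (δ : AffineGroup (2 * j) i j ≃* DihedralGroup (2 * j))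
      (θ : DihedralGroup (2 * j) →* MulAut (Fin j → Multiplicative (ZMod 2))),
      (∀ x, Φ x = (x.left : subdivCirculant (2 * j) i j p ≃g subdivCirculant (2 * j) i j p) *
        affineAut i j p x.right) ∧
      (∀ (d : AffineGroup (2 * j) i j) (b : flipSubgroup i j p) (a : ZMod (2 * j)),
        (b : subdivCirculant (2 * j) i j p ≃g subdivCirculant (2 * j) i j p) = flipAut i j p a →
        (ψ d b : subdivCirculant (2 * j) i j p ≃g subdivCirculant (2 * j) i j p) =
          flipAut i j p (d.app a)) ∧
      (∀ k : Fin j, (ε (Pi.mulSingle k (Multiplicative.ofAdd 1)) :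
          subdivCirculant (2 * j) i j p ≃g subdivCirculant (2 * j) i j p) =
        flipAut i j p ((k : ℕ) : ZMod (2 * j))) ∧
      (∀ s : ZMod (2 * j),
        δ (SemidirectProduct.inl (Multiplicative.ofAdd s)) = DihedralGroup.r s) ∧
      (∀ (d : AffineGroup (2 * j) i j) (e : Fin j → Multiplicative (ZMod 2)),
        ε (θ (δ d) e) = ψ d (ε e)) ∧
      Nonempty ((subdivCirculant (2 * j) i j p ≃g subdivCirculant (2 * j) i j p) ≃*
        (Fin j → Multiplicative (ZMod 2)) ⋊[θ] DihedralGroup (2 * j)) := by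
  have hco : Nat.Coprime i j := by
    refine Nat.dvd_one.1 (hgcd ▸ Nat.dvd_gcd (Nat.dvd_gcd ?_ ?_) ?_)
    · exact (Nat.gcd_dvd_right i j).mul_left 2
    · exact Nat.gcd_dvd_left i j
    · exact Nat.gcd_dvd_right i j
  have : NeZero j := ⟨by omega⟩
  have hN := normal_flipSubgroup hi hij hp
  let Φ := MulEquiv.ofBijective (flipAffineHom i j p) (flipAffineHom_bijective hi hij hco hp)
  let ε : (Fin j → Multiplicative (ZMod 2)) ≃* flipSubgroup i j p :=
    (MonoidHom.ofInjective (flipsAut_injective hp)).trans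
      (MulEquiv.subgroupCongr range_flipsAut)
  let δ := MulEquiv.ofBijective (affineToDihedral (by omega) hco)
    (affineToDihedral_bijective (by omega) hco)
  refine ⟨coe_unitStab' hco, hN, affineConj i j p, Φ, ε, δ,
    -- `θ` is the conjugation action transported along `ε` and `δ`.
    (MulAut.congr ε.symm).toMonoidHom.comp ((affineConj i j p).comp δ.symm.toMonoidHom),
    fun x => rfl, ?_, flipsAut_mulSingle, ?_, ?_, ⟨Φ.symm.trans (SemidirectProduct.congr' ε.symm δ)⟩⟩
  · intro d b a hb
    rw [affineConj, MonoidHom.comp_apply, MulAut.conjNormal_apply, hb, affineAut_mul_flipAut,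
      mul_inv_cancel_right]
  · intro s
    exact if_pos rfl
  · intro d e
    simp
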